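/- All graphs are finite, simple and undirected. A graph is chordal if it has no induced cycle of length at least $4$. It is cycle extendible if for every cycle $C$ that is not Hamiltonian there is a cycle $C'$ with $V(C)\subset V(C')$ and $|V(C')|=|V(C)|+1$. A graph is $k$-connected if it has more than $k$ vertices and no deletion of fewer than $k$ vertices disconnects it; its connectivity is $k$ if it is $k$-connected but not $(k+1)$-connected. For $n\ge 1$ let $S_n$ be the following graph. Take pairwise disjoint cliques $F_1,\dots,F_n,F'_1,\dots,F'_{n-1}$ with $n$ vertices each, $V(F_i)=\{v_{i,1},\dots,v_{i,n}\}$, $V(F'_i)=\{v'_{i,1},\dots,v'_{i,n}\}$, and two further vertices $z,w$. Add the edges $v_{i,n}v_{i+1,1}$ ($1\le i\le n-1$), $v_{n,n}z$, $zw$, $wv'_{n-1,1}$ (if $n\ge 2$), and $v'_{i+1,n}v'_{i,1}$ ($1\le i\le n-2$). Add a clique $\{x_1,\dots,x_n\}$, each vertex of which is adjacent to all the vertices introduced so far. Finally, for each $1\le i\le n$ add an independent set $T_i$ of $n$ new vertices, each adjacent exactly to $x_i$ and all vertices of $F_i$, and for each $1\le i\le n-1$ add an independent set $T'_i$ of $n$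 new vertices, each adjacent exactly to $x_i$ and all vertices of $F'_i$. Theorem. Let $k\ge 2$. (1) There is a Hamiltonian chordal graph of vertex connectivity exactly $k$ that is not cycle extendible. (2) The graph $S_{k-1}$ is chordal, Hamiltonian and has connectivity exactly $k$ (in particular it is $k$-connected). (3) If $k\ge 3$, then $S_{k-1}$ has a cycle with vertex set $V(S_{k-1})\setminus\{z,w\}$, but no cycle with vertex set $V(S_{k-1})\setminus\{w\}$. (4) If $k\ge 4$, then moreover $S_{k-1}$ has no cycle with vertex set $V(S_{k-1})\setminus\{z\}$, and $S_{k-1}$ is not cycle extendible. -/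

import Mathlib

/-- A graph is chordal if it contains no induced cycle of length `4` or greater. -/
def IsChordal {V : Type*} (G : SimpleGraph V) : Prop :=
  ∀ n : ℕ, 4 ≤ n → IsEmpty (SimpleGraph.cycleGraph n ↪g G)

/-- `G` contains a cycle whose vertex set is exactly `s`. -/
def HasCycleOn {V : Type*} (G : SimpleGraph V) (s : Set V) : Prop :=
  ∃ (a : V) (p : G.Walk a a), p.IsCycle ∧ {v | v ∈ p.support} = s

/-- A graph is cycle extendible if for every non-Hamiltonian cycle `C` there is a cycle `C'` with
`V(C) ⊂ V(C')` and `|V(C')| = |V(C)| + 1`. -/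
def IsCycleExtendible {V : Type*} (G : SimpleGraph V) : Prop :=
  ∀ s : Set V, HasCycleOn G s → s ≠ Set.univ →
    ∃ s' : Set V, HasCycleOn G s' ∧ s ⊂ s' ∧ s'.ncard = s.ncard + 1

/-- `G` is `k`-(vertex-)connected: it has more than `k` vertices and deleting fewer than `k`
vertices never disconnects it. -/
def IsVertexConnected {V : Type*} [Fintype V] (G : SimpleGraph V) (k : ℕ) : Prop :=
  k < Fintype.card V ∧
    ∀ D : Finset V, D.card < k → (G.induce {v | v ∉ D}).Connected

/-- The (vertex) connectivity of `G` is exactly `k`. -/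
def HasConnectivity {V : Type*} [Fintype V] (G : SimpleGraph V) (k : ℕ) : Prop :=
  IsVertexConnected G k ∧ ¬ IsVertexConnected G (k + 1)

/-- Vertices of the blow-up with `n` vertices `x_i` and blocks of size `m` (all indices start at
`0`): `x i` are the vertices of the central clique; `f i j` and `f' i j` those of the cliques
`F_i` and `F'_i`; `z` and `w` the two special path vertices (`w` is the neighbour of `z` on the
side of the cliques `F'_i`); `t i j` and `t' i j` those of the independent sets `T_i`, `T'_i`. -/
inductive BlowUpVertex (n m : ℕ) : Type
  | x (i : Fin n)
  | f (i : Fin n) (j : Fin m)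
  | f' (i : Fin (n - 1)) (j : Fin m)
  | z
  | w
  | t (i : Fin n) (j : Fin m)
  | t' (i : Fin (n - 1)) (j : Fin m)
  deriving DecidableEq, Fintype

/-- The edges of the blow-up, each listed in one direction (loops are to be ignored). -/
def BlowUpVertex.Rel {n m : ℕ} : BlowUpVertex n m → BlowUpVertex n m → Prop
  -- the `x i` form a clique that is joined to the whole chain of cliques
  | .x _, .x _ => True
  | .x _, .f _ _ => True
  | .x _, .f' _ _ => True
  | .x _, .z => True
  | .x _, .w => True
  -- the chain `F_0, …, F_{n-1}, z, w, F'_{n-2}, …, F'_0`: each `F_i` and `F'_i` is a clique, and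
  -- the last vertex of each link is adjacent to the first vertex of the next link
  | .f i j, .f i' j' =>
      i = i' ∨ ((i' : ℕ) = (i : ℕ) + 1 ∧ (j : ℕ) + 1 = m ∧ (j' : ℕ) = 0)
  | .f i j, .z => (i : ℕ) + 1 = n ∧ (j : ℕ) + 1 = m
  | .z, .w => True
  | .w, .f' i j => (i : ℕ) + 1 = n - 1 ∧ (j : ℕ) = 0
  | .f' i j, .f' i' j' =>
      i = i' ∨ ((i : ℕ) = (i' : ℕ) + 1 ∧ (j : ℕ) + 1 = m ∧ (j' : ℕ) = 0)
  -- `T_i` is complete to `F_i` and `x i`, and `T'_i` is complete to `F'_i` and `x i`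
  | .t i _, .f i' _ => i = i'
  | .t i _, .x i' => i = i'
  | .t' i _, .f' i' _ => i = i'
  | .t' i _, .x i' => (i : ℕ) = (i' : ℕ)
  | _, _ => False

/-- The blow-up with `n` vertices `x_i` and blocks of size `m`. -/
def blowUp (n m : ℕ) : SimpleGraph (BlowUpVertex n m) :=
  SimpleGraph.fromRel BlowUpVertex.Rel

/-- The blow-up `S_n`, in which all cliques `F_i`, `F'_i` and all independent sets `T_i`, `T'_i`
have `n` vertices. -/
def blowUpS (n : ℕ) : SimpleGraph (BlowUpVertex n n) := blowUp n n

/-! Indices start at `0`. The obstruction is a count. Each `T i` is an independent set of `m`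
vertices whose neighbours are `x i` and the `m` vertices of `F i`. A cycle through all of these must
use an edge from `x i` to `T i`, for otherwise `T i` would exhaust both edges at every vertex of `F
i` and `T i ∪ F i` would be the entire cycle. The same holds for `T' i`, so for `i < n - 1` both
cycle edges at `x i` are spent on `T i` and `T' i`. Only the last central vertex remains available
to `z` and `w`.

Suppose a cycle misses only `w`. Then `z` and the last `T` form `m + 1` vertices whose cycle
neighbours lie among the `m + 1` vertices of the last `F` and its `x`, so the cycle is trapped there
(`not_hasCycleOn_ne_w`). If it misses only `z`, then `w` must use the last `x`, which forces a cycle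
edge between the last two cliques `F`; the same count on a larger set with excess one then traps the
cycle (`not_hasCycleOn_ne_z`). The cycle missing exactly `z` and `w` therefore has no one-vertex
extension.

That cycle and a Hamiltonian one come from a serpentine path through the blocks
(`hasPathOn_level_le`). Chordality follows from an elimination ordering, and connectivity `m + 1`
from the degrees of the vertices in the sets `T i` and `T' i`, provided that `m ≤ n`. Keeping `n`
and `m` separate lets part (1) cover small `k`. -/

/-! ### Paths and cycles with prescribed vertex sets -/

section Paths

variable {V : Type*} {G : SimpleGraph V}

/-- `G` contains a path from `a` to `b` whose vertex set is exactly `s`. -/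
def HasPathOn (G : SimpleGraph V) (a b : V) (s : Set V) : Prop :=
  ∃ p : G.Walk a b, p.IsPath ∧ {v | v ∈ p.support} = s

theorem HasPathOn.singleton (G : SimpleGraph V) (a : V) : HasPathOn G a a {a} :=
  ⟨.nil, by simp, by ext; simp⟩

theorem HasPathOn.symm {a b : V} {s : Set V} (h : HasPathOn G a b s) : HasPathOn G b a s := by
  obtain ⟨p, hp, rfl⟩ := h
  exact ⟨p.reverse, hp.reverse, by simp⟩

theorem HasPathOn.trans {a b c d : V} {s t : Set V} (h₁ : HasPathOn G a b s)
    (h : G.Adj b c) (h₂ : HasPathOn G c d t) (hst : Disjoint s t) :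
    HasPathOn G a d (s ∪ t) := by
  obtain ⟨p, hp, rfl⟩ := h₁
  obtain ⟨q, hq, rfl⟩ := h₂
  refine ⟨p.append (.cons h q), ?_, ?_⟩
  · rw [SimpleGraph.Walk.isPath_def, SimpleGraph.Walk.support_append]
    simp only [SimpleGraph.Walk.support_cons, List.tail_cons]
    rw [List.nodup_append]
    refine ⟨hp.support_nodup, hq.support_nodup, ?_⟩
    rintro x hx y hy rfl
    exact Set.disjoint_left.1 hst hx hy
  · ext v
    simp [SimpleGraph.Walk.support_append]

/-- The third vertex `c` excludes the path that is just the edge `ab`, which would close up to a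
walk traversing that edge twice. -/
theorem HasPathOn.hasCycleOn {a b c : V} {s : Set V} (h : HasPathOn G a b s)
    (hba : G.Adj b a) (hc : c ∈ s) (hca : c ≠ a) (hcb : c ≠ b) : HasCycleOn G s := by
  obtain ⟨p, hp, rfl⟩ := h
  refine ⟨b, .cons hba p, ?_, ?_⟩
  · rw [SimpleGraph.Walk.cons_isCycle_iff]
    refine ⟨hp, fun he => ?_⟩
    cases p with
    | nil => simp at hba
    | @cons _ d _ h q =>
      rw [SimpleGraph.Walk.cons_isPath_iff] at hp
      rw [SimpleGraph.Walk.edges_cons, List.mem_cons] at he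
      rcases he with he | he
      · have : b = d := by
          rcases Sym2.eq_iff.1 he with ⟨h1, h2⟩ | ⟨h1, -⟩
          · exact absurd h1 hba.ne
          · exact h1
        subst this
        have := (SimpleGraph.Walk.isPath_iff_nil.1 hp.1).eq_nil
        subst this
        simp at hc
        tauto
      · exact hp.2 (SimpleGraph.Walk.snd_mem_support_of_mem_edges q he)
  · ext v
    simp only [SimpleGraph.Walk.support_cons, List.mem_cons, Set.mem_ofPred_eq,
      or_iff_right_iff_imp]
    rintro rfl
    exact p.end_mem_support

/-- A balanced complete bipartite graph is spanned by a path between any two vertices on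
different sides. -/
theorem hasPathOn_union_of_forall_adj [DecidableEq V] {F T : Finset V} (hcard : F.card = T.card)
    (hdisj : Disjoint F T) (hadj : ∀ f ∈ F, ∀ t ∈ T, G.Adj f t) {a b : V} (ha : a ∈ F)
    (hb : b ∈ T) : HasPathOn G a b (F ∪ T) := by
  induction hn : F.card generalizing F T a with
  | zero => simp [Finset.card_eq_zero.1 hn] at ha
  | succ n ih =>
    rcases n with _ | n
    · obtain ⟨a', rfl⟩ := Finset.card_eq_one.1 hn
      obtain ⟨b', rfl⟩ := Finset.card_eq_one.1 (hcard ▸ hn)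
      simp only [Finset.mem_singleton] at ha hb
      subst ha hb
      simpa using (HasPathOn.singleton G a).trans (hadj a (by simp) b (by simp))
        (HasPathOn.singleton G b) (by simpa using hdisj)
    -- Start with `a`, `t`, `f` and recurse from `f`; `t ≠ b` keeps the prescribed end available.
    · obtain ⟨t, ht, htb⟩ := Finset.exists_mem_ne (s := T) (by omega) b
      obtain ⟨f, hf, hfa⟩ := Finset.exists_mem_ne (s := F) (by omega) a
      have hat : a ≠ t := (hadj a ha t ht).ne
      have h := ih (F := F.erase a) (T := T.erase t) (a := f)
        (by rw [Finset.card_erase_of_mem ha, Finset.card_erase_of_mem ht, hcard])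
        (hdisj.mono (Finset.erase_subset _ _) (Finset.erase_subset _ _))
        (fun f hf t ht => hadj f (Finset.mem_of_mem_erase hf) t (Finset.mem_of_mem_erase ht))
        (by simp [hf, hfa]) (by simp [hb, htb.symm])
        (by rw [Finset.card_erase_of_mem ha, hn]; rfl)
      have h1 := ((HasPathOn.singleton G a).trans (hadj a ha t ht)
        (HasPathOn.singleton G t) (by simpa using hat)).trans (hadj f hf t ht).symm h
        (by
          have h1 : t ∉ F := fun h => Finset.disjoint_left.1 hdisj h ht
          have h2 : a ∉ T := fun h => Finset.disjoint_left.1 hdisj ha h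
          simp [h1, h2])
      convert h1 using 1
      ext v
      simp only [Set.mem_union, Finset.mem_coe, Set.mem_singleton_iff, Finset.coe_erase,
        Set.mem_sdiff]
      by_cases hva : v = a <;> by_cases hvt : v = t <;> simp_all

end Paths

theorem HasCycleOn.isHamiltonian {V : Type*} [Fintype V] [DecidableEq V] {G : SimpleGraph V}
    (h : HasCycleOn G Set.univ) : G.IsHamiltonian := by
  intro _
  obtain ⟨a, p, hp, hs⟩ := h
  refine ⟨a, p, ?_⟩
  rw [SimpleGraph.Walk.isHamiltonianCycle_iff_isCycle_and_support_count_tail_eq_one]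
  refine ⟨hp, fun v => List.count_eq_one_of_mem hp.support_nodup ?_⟩
  have hv : v ∈ p.support := by
    have : v ∈ {v | v ∈ p.support} := hs ▸ Set.mem_univ v
    exact this
  cases p with
  | nil => simp at hp
  | cons h q =>
    simp only [SimpleGraph.Walk.support_cons, List.mem_cons, List.tail_cons] at hv ⊢
    rcases hv with rfl | hv
    · exact q.end_mem_support
    · exact hv

/-! ### Chordality from an elimination ordering -/

/-- A graph with a ranking in which the neighbours of each vertex that are not ranked lower form
a clique is chordal. -/
theorem isChordal_of_rank {V R : Type*} [LinearOrder R] {G : SimpleGraph V} (r : V → R)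
    (h : ∀ v a b, G.Adj v a → G.Adj v b → r v ≤ r a → r v ≤ r b → a ≠ b → G.Adj a b) :
    IsChordal G := by
  rintro n hn
  refine ⟨fun e => ?_⟩
  obtain ⟨n, rfl⟩ : ∃ k, n = k + 4 := ⟨n - 4, by omega⟩
  obtain ⟨i, hi⟩ := Finite.exists_min (fun i => r (e i))
  have h1 : (SimpleGraph.cycleGraph (n + 4)).Adj i (i + 1) := by
    rw [SimpleGraph.cycleGraph_adj]; right; simp
  have h2 : (SimpleGraph.cycleGraph (n + 4)).Adj i (i - 1) := by
    rw [SimpleGraph.cycleGraph_adj]; left; simp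
  -- The two cycle neighbours of a vertex of minimal rank differ by `2`; length at least `4` makes
  -- them distinct and non-adjacent.
  have key : ∀ d : Fin (n + 4), d = 1 + 1 → d ≠ 0 ∧ d ≠ 1 ∧ - d ≠ 1 := by
    rintro d rfl
    have e2 : ((1 : Fin (n + 4)) + 1) = ⟨2, by omega⟩ := by
      ext; simp [Fin.val_add, Nat.mod_eq_of_lt]
    rw [e2]
    refine ⟨?_, ?_, ?_⟩
    · simp [Fin.ext_iff]
    · simp [Fin.ext_iff]
    · simp [Fin.ext_iff, Fin.val_neg']
      rw [Nat.mod_eq_of_lt] <;> omega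
  obtain ⟨k0, k1, k2⟩ := key _ rfl
  have hne : i + 1 ≠ i - 1 := by
    intro h
    apply k0
    have := sub_eq_zero.2 h
    rw [← this]; abel
  have h3 := h (e i) (e (i + 1)) (e (i - 1)) (e.map_adj_iff.2 h1) (e.map_adj_iff.2 h2) (hi _) (hi _)
    (fun h => hne (e.injective h))
  rw [e.map_adj_iff, SimpleGraph.cycleGraph_adj] at h3
  rcases h3 with h3 | h3
  · exact k1 ((show 1 + 1 = i + 1 - (i - 1) by abel).trans h3)
  · exact k2 ((show -(1 + 1) = i - 1 - (i + 1) by abel).trans h3)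

/-! ### Edge counting in connected 2-regular graphs -/

section Cycles

/-- `H` is a connected `2`-regular graph on the vertex set `s`. -/
structure IsCycleGraphOn {V : Type*} [Fintype V] (H : SimpleGraph V) [DecidableRel H.Adj]
    (s : Set V) : Prop where
  degree_eq : ∀ v ∈ s, H.degree v = 2
  mem : ∀ {v u}, H.Adj v u → v ∈ s
  eq_of_closed : ∀ A : Set V, A ⊆ s → A.Nonempty → (∀ a ∈ A, ∀ b, H.Adj a b → b ∈ A) → A = s

-- Passing from the walk to its graph forgets base point and direction; the impossibility arguments
-- use only degrees and closed sets.
open Classical in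
theorem HasCycleOn.exists_isCycleGraphOn {V : Type*} [Fintype V] {G : SimpleGraph V} {s : Set V}
    (h : HasCycleOn G s) : ∃ H : SimpleGraph V, H ≤ G ∧ IsCycleGraphOn H s := by
  obtain ⟨a, p, hp, rfl⟩ := h
  have hmem : ∀ {v u}, p.toSubgraph.spanningCoe.Adj v u → v ∈ p.support := by
    intro v u h
    have : v ∈ p.toSubgraph.verts := p.toSubgraph.edge_vert h
    simpa using this
  refine ⟨p.toSubgraph.spanningCoe, p.toSubgraph.spanningCoe_le, ?_, hmem, ?_⟩
  · intro v hv
    have := hp.ncard_neighborSet_toSubgraph_eq_two hv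
    rw [← SimpleGraph.card_neighborFinset_eq_degree, ← Set.ncard_coe_finset]
    rw [← this]
    congr 1
    ext u
    simp
  · intro A hA ⟨b, hb⟩ hcl
    refine hA.antisymm fun v hv => ?_
    have hconn := p.toSubgraph_connected
    rw [SimpleGraph.Subgraph.connected_iff'] at hconn
    have hb' : b ∈ p.toSubgraph.verts := by simpa using hA hb
    have hv' : v ∈ p.toSubgraph.verts := by simpa using hv
    obtain ⟨q⟩ := hconn.preconnected ⟨b, hb'⟩ ⟨v, hv'⟩
    have aux : ∀ {x y : p.toSubgraph.verts}, p.toSubgraph.coe.Walk x y → (x : V) ∈ A →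
        (y : V) ∈ A := by
      intro x y q
      induction q with
      | nil => exact id
      | cons h q ih =>
        intro hx
        exact ih (hcl _ hx _ h)
    exact aux q hb

namespace IsCycleGraphOn

variable {V : Type*} [Fintype V] {H : SimpleGraph V} [DecidableRel H.Adj] {s : Set V}

theorem mem_or_mem_of_forall (hH : IsCycleGraphOn H s) {T N : Finset V} (hT : ∀ t ∈ T, t ∈ s)
    (hN : ∀ v ∈ N, v ∈ s) (hTN : ∀ t ∈ T, ∀ u, H.Adj t u → u ∈ N) (hne : T.Nonempty)
    (hNT : ∀ v ∈ N, ∀ u, H.Adj v u → u ∈ T ∨ u ∈ N) {v : V} (hv : v ∈ s) : v ∈ T ∨ v ∈ N := by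
  have := hH.eq_of_closed (↑T ∪ ↑N) (by
      rintro a (ha | ha)
      · exact hT a ha
      · exact hN a ha)
    (by obtain ⟨t, ht⟩ := hne; exact ⟨t, Or.inl ht⟩)
    (by
      rintro a (ha | ha) b hab
      · exact Or.inr (hTN a ha b hab)
      · exact hNT a ha b hab)
  rw [← this] at hv
  exact hv

variable [DecidableEq V]

theorem eq_or_eq (hH : IsCycleGraphOn H s) {v a b c : V} (ha : H.Adj v a) (hb : H.Adj v b)
    (hab : a ≠ b) (hc : H.Adj v c) : c = a ∨ c = b := by
  by_contra! hcon
  have h1 : ({a, b, c} : Finset V) ⊆ H.neighborFinset v := by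
    intro u hu
    simp only [Finset.mem_insert, Finset.mem_singleton] at hu
    rw [SimpleGraph.mem_neighborFinset]
    rcases hu with rfl | rfl | rfl <;> assumption
  have h2 := Finset.card_le_card h1
  rw [Finset.card_eq_three.2 ⟨a, b, c, hab, hcon.1.symm, hcon.2.symm, rfl⟩,
    SimpleGraph.card_neighborFinset_eq_degree, hH.degree_eq v (hH.mem ha)] at h2
  omega

theorem adj_of_forall (hH : IsCycleGraphOn H s) {v a b : V} (hv : v ∈ s)
    (h : ∀ u, H.Adj v u → u = a ∨ u = b) : H.Adj v a ∧ H.Adj v b := by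
  have h1 : H.neighborFinset v ⊆ {a, b} := by
    intro u hu
    simpa using h u (by simpa using hu)
  have h2 : ({a, b} : Finset V).card ≤ (H.neighborFinset v).card := by
    rw [SimpleGraph.card_neighborFinset_eq_degree, hH.degree_eq v hv]
    exact Finset.card_le_two
  have h3 := Finset.eq_of_subset_of_card_le h1 h2
  constructor
  · rw [← SimpleGraph.mem_neighborFinset, h3]; simp
  · rw [← SimpleGraph.mem_neighborFinset, h3]; simp

/-- Counting the edges that leave `N` other than towards a set `T` all of whose neighbours lie in
`N`. -/
theorem card_sigma_add (hH : IsCycleGraphOn H s) {T N : Finset V} (hT : ∀ t ∈ T, t ∈ s)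
    (hN : ∀ v ∈ N, v ∈ s) (hTN : ∀ t ∈ T, ∀ u, H.Adj t u → u ∈ N) :
    (N.sigma fun v => H.neighborFinset v \ T).card + 2 * T.card = 2 * N.card := by
  have h1 : ∑ v ∈ N, (H.neighborFinset v ∩ T).card = 2 * T.card := by
    have := Finset.sum_card_bipartiteAbove_eq_sum_card_bipartiteBelow (s := N) (t := T) H.Adj
    rw [mul_comm, ← smul_eq_mul, ← Finset.sum_const]
    convert this using 2 with v hv v hv
    · congr 1
      ext u
      simp [Finset.bipartiteAbove, and_comm]
    · rw [← hH.degree_eq v (hT v hv), ← SimpleGraph.card_neighborFinset_eq_degree]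
      congr 1
      ext u
      simp only [SimpleGraph.mem_neighborFinset, Finset.bipartiteBelow, Finset.mem_filter]
      exact ⟨fun h => ⟨hTN v hv u h, h.symm⟩, fun h => h.2.symm⟩
  rw [Finset.card_sigma, ← h1, ← Finset.sum_add_distrib, mul_comm, ← smul_eq_mul,
    ← Finset.sum_const]
  refine Finset.sum_congr rfl fun v hv => ?_
  rw [Finset.card_sdiff_add_card_inter, SimpleGraph.card_neighborFinset_eq_degree,
    hH.degree_eq v (hN v hv)]

/-- If `T` has one vertex less than the set `N` containing its neighbours, then at most two edges
leave `N` other than towards `T`. -/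
theorem not_three_adj (hH : IsCycleGraphOn H s) {T N : Finset V} (hT : ∀ t ∈ T, t ∈ s)
    (hN : ∀ v ∈ N, v ∈ s) (hTN : ∀ t ∈ T, ∀ u, H.Adj t u → u ∈ N) (hcard : N.card ≤ T.card + 1)
    {e₁ e₂ e₃ : V × V} (h₁ : e₁.1 ∈ N ∧ H.Adj e₁.1 e₁.2 ∧ e₁.2 ∉ T)
    (h₂ : e₂.1 ∈ N ∧ H.Adj e₂.1 e₂.2 ∧ e₂.2 ∉ T) (h₃ : e₃.1 ∈ N ∧ H.Adj e₃.1 e₃.2 ∧ e₃.2 ∉ T)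
    (h12 : e₁ ≠ e₂) (h13 : e₁ ≠ e₃) (h23 : e₂ ≠ e₃) : False := by
  have h := hH.card_sigma_add hT hN hTN
  have hs : (({e₁, e₂, e₃} : Finset (V × V)).map
      (Equiv.sigmaEquivProd V V).symm.toEmbedding) ⊆
      N.sigma fun v => H.neighborFinset v \ T := by
    intro e he
    simp only [Finset.mem_map, Finset.mem_insert, Finset.mem_singleton] at he
    obtain ⟨e', he', rfl⟩ := he
    rcases he' with rfl | rfl | rfl <;> simpa
  have := Finset.card_le_card hs
  rw [Finset.card_map, Finset.card_eq_three.2 ⟨e₁, e₂, e₃, h12, h13, h23, rfl⟩] at this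
  omega

theorem exists_adj_ne (hH : IsCycleGraphOn H s) {T N : Finset V} (hT : ∀ t ∈ T, t ∈ s)
    (hN : ∀ v ∈ N, v ∈ s) (hTN : ∀ t ∈ T, ∀ u, H.Adj t u → u ∈ N) (hcard : T.card + 1 ≤ N.card)
    (a b : V) : ∃ v ∈ N, ∃ u ∉ T, H.Adj v u ∧ (v, u) ≠ (a, b) := by
  have h := hH.card_sigma_add hT hN hTN
  obtain ⟨⟨v, u⟩, hvu, hne⟩ := Finset.exists_mem_ne (s := N.sigma fun v => H.neighborFinset v \ T)
    (by omega) ⟨a, b⟩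
  simp only [Finset.mem_sigma, Finset.mem_sdiff, SimpleGraph.mem_neighborFinset] at hvu
  exact ⟨v, hvu.1, u, hvu.2.2, hvu.2.1, by simpa using hne⟩

/-- The edges at `T` already use up all degrees in `N`, so `T ∪ N` is closed under adjacency in the
cycle. -/
theorem mem_or_mem_of_card_le (hH : IsCycleGraphOn H s) {T N : Finset V} (hT : ∀ t ∈ T, t ∈ s)
    (hN : ∀ v ∈ N, v ∈ s) (hTN : ∀ t ∈ T, ∀ u, H.Adj t u → u ∈ N) (hne : T.Nonempty)
    (hcard : N.card ≤ T.card) {v : V} (hv : v ∈ s) : v ∈ T ∨ v ∈ N := by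
  refine hH.mem_or_mem_of_forall hT hN hTN hne (fun v hv u hvu => Or.inl ?_) hv
  have h := hH.card_sigma_add hT hN hTN
  by_contra hu
  have := Finset.card_pos.2 ⟨(⟨v, u⟩ : Σ _ : V, V), (by simp [hv, hu, hvu] :
    _ ∈ N.sigma fun v => H.neighborFinset v \ T)⟩
  omega

/-- With excess one, two edge ends in `N` are left over. The count is over ordered pairs, so a
single edge inside `N` consumes both and nothing leaves `T ∪ N`. -/
theorem mem_or_mem_of_adj (hH : IsCycleGraphOn H s) {T N : Finset V} (hT : ∀ t ∈ T, t ∈ s)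
    (hN : ∀ v ∈ N, v ∈ s) (hTN : ∀ t ∈ T, ∀ u, H.Adj t u → u ∈ N) (hne : T.Nonempty)
    (hcard : N.card ≤ T.card + 1) {a b : V} (hab : H.Adj a b) (ha : a ∈ N) (hb : b ∈ N)
    (haT : a ∉ T) (hbT : b ∉ T) {v : V} (hv : v ∈ s) : v ∈ T ∨ v ∈ N := by
  refine hH.mem_or_mem_of_forall hT hN hTN hne (fun v hv u hvu => ?_) hv
  by_contra! hu
  refine hH.not_three_adj hT hN hTN hcard (e₁ := (a, b)) (e₂ := (b, a)) (e₃ := (v, u))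
    ⟨ha, hab, hbT⟩ ⟨hb, hab.symm, haT⟩ ⟨hv, hvu, hu.1⟩ ?_ ?_ ?_
  · simp [hab.ne]
  · rintro ⟨⟩
    exact hu.2 hb
  · rintro ⟨⟩
    exact hu.2 ha

end IsCycleGraphOn
end Cycles

/-! ### Elimination ordering and vertex sets of the blow-up -/

namespace BlowUpVertex

variable {n m : ℕ}

/-- The lexicographic position in an elimination ordering of the blow-up. -/
def rank : BlowUpVertex n m → ℕ ×ₗ ℕ
  | .x _ => toLex (3 * n + 5, 0)
  | .f i j => toLex (i + 1, j)
  | .f' i j => toLex (2 * n + 2 - i, j)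
  | .z => toLex (n + 1, 0)
  | .w => toLex (n + 2, 0)
  | .t _ _ => toLex (0, 0)
  | .t' _ _ => toLex (0, 0)

end BlowUpVertex

open BlowUpVertex

variable {n m : ℕ}

theorem isChordal_blowUp : IsChordal (blowUp n m) := by
  refine isChordal_of_rank BlowUpVertex.rank ?_
  intro v a b hva hvb hra hrb hab
  rcases v with i | ⟨i, j⟩ | ⟨i, j⟩ | _ | _ | ⟨i, j⟩ | ⟨i, j⟩ <;>
  rcases a with i' | ⟨i', j'⟩ | ⟨i', j'⟩ | _ | _ | ⟨i', j'⟩ | ⟨i', j'⟩ <;>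
  rcases b with k | ⟨k, l⟩ | ⟨k, l⟩ | _ | _ | ⟨k, l⟩ | ⟨k, l⟩ <;>
  simp only [blowUp, SimpleGraph.fromRel_adj, BlowUpVertex.Rel, BlowUpVertex.rank,
    Prod.Lex.toLex_le_toLex, ne_eq, reduceCtorEq, not_false_eq_true, true_and, and_false,
    or_false, false_or, false_and, and_true, true_or, not_true_eq_false, BlowUpVertex.f.injEq,
    BlowUpVertex.f'.injEq, BlowUpVertex.x.injEq, BlowUpVertex.t.injEq, BlowUpVertex.t'.injEq,
    Fin.ext_iff] at hva hvb hra hrb hab ⊢ <;>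
  omega

namespace BlowUpVertex

/-- The vertices of `F_i`. -/
def F (i : Fin n) : Finset (BlowUpVertex n m) := Finset.univ.image (BlowUpVertex.f i)
/-- The vertices of `T_i`. -/
def T (i : Fin n) : Finset (BlowUpVertex n m) := Finset.univ.image (BlowUpVertex.t i)
/-- The vertices of `F'_i`. -/
def F' (i : Fin (n - 1)) : Finset (BlowUpVertex n m) := Finset.univ.image (BlowUpVertex.f' i)
/-- The vertices of `T'_i`. -/
def T' (i : Fin (n - 1)) : Finset (BlowUpVertex n m) := Finset.univ.image (BlowUpVertex.t' i)

@[simp] theorem mem_F {i : Fin n} {v : BlowUpVertex n m} : v ∈ F i ↔ ∃ j, f i j = v := by simp [F]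
@[simp] theorem mem_T {i : Fin n} {v : BlowUpVertex n m} : v ∈ T i ↔ ∃ j, t i j = v := by simp [T]
@[simp] theorem mem_F' {i : Fin (n - 1)} {v : BlowUpVertex n m} : v ∈ F' i ↔ ∃ j, f' i j = v := by
  simp [F']
@[simp] theorem mem_T' {i : Fin (n - 1)} {v : BlowUpVertex n m} : v ∈ T' i ↔ ∃ j, t' i j = v := by
  simp [T']

@[simp] theorem card_F (i : Fin n) : (F i : Finset (BlowUpVertex n m)).card = m := by
  rw [F, Finset.card_image_of_injective _ (fun a b h => by simpa using h)]; simp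
@[simp] theorem card_T (i : Fin n) : (T i : Finset (BlowUpVertex n m)).card = m := by
  rw [T, Finset.card_image_of_injective _ (fun a b h => by simpa using h)]; simp
@[simp] theorem card_F' (i : Fin (n - 1)) : (F' i : Finset (BlowUpVertex n m)).card = m := by
  rw [F', Finset.card_image_of_injective _ (fun a b h => by simpa using h)]; simp
@[simp] theorem card_T' (i : Fin (n - 1)) : (T' i : Finset (BlowUpVertex n m)).card = m := by
  rw [T', Finset.card_image_of_injective _ (fun a b h => by simpa using h)]; simp

end BlowUpVertex

/-! ### Neighbourhoods in the blow-up -/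

section Adjacency

theorem blowUp_adj_x_iff {i : Fin n} {v : BlowUpVertex n m} :
    (blowUp n m).Adj (x i) v ↔ v ≠ x i ∧ (∀ k j, v = t k j → k = i) ∧
      (∀ k j, v = t' k j → (k : ℕ) = i) := by
  rcases v with k | ⟨k, l⟩ | ⟨k, l⟩ | _ | _ | ⟨k, l⟩ | ⟨k, l⟩ <;>
    simp [blowUp, BlowUpVertex.Rel, eq_comm]

theorem blowUp_adj_t_iff {i : Fin n} {j : Fin m} {v : BlowUpVertex n m} :
    (blowUp n m).Adj (t i j) v ↔ v = x i ∨ ∃ l, v = f i l := by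
  rcases v with k | ⟨k, l⟩ | ⟨k, l⟩ | _ | _ | ⟨k, l⟩ | ⟨k, l⟩ <;>
    simp [blowUp, BlowUpVertex.Rel, eq_comm]

theorem blowUp_adj_t'_iff {i : Fin (n - 1)} {j : Fin m} {v : BlowUpVertex n m} :
    (blowUp n m).Adj (t' i j) v ↔ v = x (i.castLE (n.sub_le 1)) ∨ ∃ l, v = f' i l := by
  rcases v with k | ⟨k, l⟩ | ⟨k, l⟩ | _ | _ | ⟨k, l⟩ | ⟨k, l⟩ <;>
    simp [blowUp, BlowUpVertex.Rel, eq_comm, Fin.ext_iff]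

theorem blowUp_adj_f_f_iff {i k : Fin n} {j l : Fin m} :
    (blowUp n m).Adj (f i j) (f k l) ↔ (i = k ∧ j ≠ l) ∨
      ((k : ℕ) = i + 1 ∧ (j : ℕ) + 1 = m ∧ (l : ℕ) = 0) ∨
      ((i : ℕ) = k + 1 ∧ (l : ℕ) + 1 = m ∧ (j : ℕ) = 0) := by
  simp only [blowUp, SimpleGraph.fromRel_adj, BlowUpVertex.Rel, ne_eq, f.injEq, Fin.ext_iff]
  omega

theorem blowUp_adj_f'_f'_iff {i k : Fin (n - 1)} {j l : Fin m} :
    (blowUp n m).Adj (f' i j) (f' k l) ↔ (i = k ∧ j ≠ l) ∨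
      ((i : ℕ) = k + 1 ∧ (j : ℕ) + 1 = m ∧ (l : ℕ) = 0) ∨
      ((k : ℕ) = i + 1 ∧ (l : ℕ) + 1 = m ∧ (j : ℕ) = 0) := by
  simp only [blowUp, SimpleGraph.fromRel_adj, BlowUpVertex.Rel, ne_eq, f'.injEq, Fin.ext_iff]
  omega

theorem blowUp_adj_z_iff {v : BlowUpVertex n m} :
    (blowUp n m).Adj z v ↔ (∃ i, v = x i) ∨ v = w ∨
      ∃ (i : Fin n) (j : Fin m), (i : ℕ) + 1 = n ∧ (j : ℕ) + 1 = m ∧ v = f i j := by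
  rcases v with k | ⟨k, l⟩ | ⟨k, l⟩ | _ | _ | ⟨k, l⟩ | ⟨k, l⟩ <;>
    simp [blowUp, BlowUpVertex.Rel]

theorem blowUp_adj_w_iff {v : BlowUpVertex n m} :
    (blowUp n m).Adj w v ↔ (∃ i, v = x i) ∨ v = z ∨
      ∃ (i : Fin (n - 1)) (j : Fin m), (i : ℕ) + 1 = n - 1 ∧ (j : ℕ) = 0 ∧ v = f' i j := by
  rcases v with k | ⟨k, l⟩ | ⟨k, l⟩ | _ | _ | ⟨k, l⟩ | ⟨k, l⟩ <;>
    simp [blowUp, BlowUpVertex.Rel]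

end Adjacency

/-! ### No cycle misses exactly one of `z` and `w` -/

section NoCycle

variable {H : SimpleGraph (BlowUpVertex n m)} {s : Set (BlowUpVertex n m)}

theorem mem_of_adj_T (hG : H ≤ blowUp n m) {i : Fin n} {v u : BlowUpVertex n m} (hv : v ∈ T i)
    (h : H.Adj v u) : u = x i ∨ u ∈ F i := by
  obtain ⟨j, rfl⟩ := mem_T.1 hv
  rcases blowUp_adj_t_iff.1 (hG h) with rfl | ⟨l, rfl⟩ <;> simp

theorem mem_of_adj_T' (hG : H ≤ blowUp n m) {i : Fin (n - 1)} {v u : BlowUpVertex n m}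
    (hv : v ∈ T' i) (h : H.Adj v u) : u = x (i.castLE (n.sub_le 1)) ∨ u ∈ F' i := by
  obtain ⟨j, rfl⟩ := mem_T'.1 hv
  rcases blowUp_adj_t'_iff.1 (hG h) with rfl | ⟨l, rfl⟩ <;> simp

variable [DecidableRel H.Adj]

/-- Otherwise the `m` vertices of `T i` have all their cycle edges into the `m` vertices of `F i`,
and the cycle cannot reach `x i`. -/
theorem exists_adj_t (hm : 1 ≤ m) (hG : H ≤ blowUp n m) (hH : IsCycleGraphOn H s)
    (hs : ∀ v, v ≠ z → v ≠ w → v ∈ s) (i : Fin n) : ∃ j, H.Adj (x i) (t i j) := by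
  by_contra! hcon
  have := hH.mem_or_mem_of_card_le (T := T i) (N := F i) (v := x i)
    (fun v hv => by obtain ⟨j, rfl⟩ := mem_T.1 hv; exact hs _ (by simp) (by simp))
    (fun v hv => by obtain ⟨j, rfl⟩ := mem_F.1 hv; exact hs _ (by simp) (by simp))
    (fun v hv u hvu => by
      refine (mem_of_adj_T hG hv hvu).resolve_left ?_
      rintro rfl
      obtain ⟨j, rfl⟩ := mem_T.1 hv
      exact hcon j hvu.symm)
    ⟨t i ⟨0, hm⟩, by simp⟩ (by simp) (hs _ (by simp) (by simp))
  simp at this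

theorem exists_adj_t' (hm : 1 ≤ m) (hG : H ≤ blowUp n m) (hH : IsCycleGraphOn H s)
    (hs : ∀ v, v ≠ z → v ≠ w → v ∈ s) (i : Fin (n - 1)) :
    ∃ j, H.Adj (x (i.castLE (n.sub_le 1))) (t' i j) := by
  by_contra! hcon
  have := hH.mem_or_mem_of_card_le (T := T' i) (N := F' i) (v := x (i.castLE (n.sub_le 1)))
    (fun v hv => by obtain ⟨j, rfl⟩ := mem_T'.1 hv; exact hs _ (by simp) (by simp))
    (fun v hv => by obtain ⟨j, rfl⟩ := mem_F'.1 hv; exact hs _ (by simp) (by simp))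
    (fun v hv u hvu => by
      refine (mem_of_adj_T' hG hv hvu).resolve_left ?_
      rintro rfl
      obtain ⟨j, rfl⟩ := mem_T'.1 hv
      exact hcon j hvu.symm)
    ⟨t' i ⟨0, hm⟩, by simp⟩ (by simp) (hs _ (by simp) (by simp))
  simp at this

/-- Both edges at `x i`, `i < n - 1`, lead to `T_i ∪ T'_i`. -/
theorem mem_T_or_mem_T'_of_adj (hm : 1 ≤ m) (hG : H ≤ blowUp n m) (hH : IsCycleGraphOn H s)
    (hs : ∀ v, v ≠ z → v ≠ w → v ∈ s) {i : Fin n} (hi : (i : ℕ) < n - 1) {u : BlowUpVertex n m}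
    (h : H.Adj (x i) u) : u ∈ T i ∨ u ∈ T' ⟨i, hi⟩ := by
  obtain ⟨j, hj⟩ := exists_adj_t hm hG hH hs i
  obtain ⟨k, hk⟩ := exists_adj_t' hm hG hH hs ⟨i, hi⟩
  rcases hH.eq_or_eq hj hk (by simp) h with rfl | rfl <;> simp

theorem eq_or_eq_of_adj_z (hm : 1 ≤ m) (hn : 1 ≤ n) (hG : H ≤ blowUp n m)
    (hH : IsCycleGraphOn H s) (hs : ∀ v, v ≠ z → v ≠ w → v ∈ s) (hw : w ∉ s)
    {u : BlowUpVertex n m} (h : H.Adj z u) :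
    u = x ⟨n - 1, by omega⟩ ∨ u = f ⟨n - 1, by omega⟩ ⟨m - 1, by omega⟩ := by
  rcases blowUp_adj_z_iff.1 (hG h) with ⟨i, rfl⟩ | rfl | ⟨i, j, hi, hj, rfl⟩
  · by_cases hi : (i : ℕ) < n - 1
    · have := mem_T_or_mem_T'_of_adj hm hG hH hs hi h.symm
      simp at this
    · left
      simp [Fin.ext_iff]
      omega
  · exact absurd (hH.mem h.symm) hw
  · right
    simp [Fin.ext_iff]
    omega

theorem eq_or_eq_of_adj_w (hm : 1 ≤ m) (hn : 2 ≤ n) (hG : H ≤ blowUp n m)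
    (hH : IsCycleGraphOn H s) (hs : ∀ v, v ≠ z → v ≠ w → v ∈ s) (hz : z ∉ s)
    {u : BlowUpVertex n m} (h : H.Adj w u) :
    u = x ⟨n - 1, by omega⟩ ∨ u = f' ⟨n - 2, by omega⟩ ⟨0, by omega⟩ := by
  rcases blowUp_adj_w_iff.1 (hG h) with ⟨i, rfl⟩ | rfl | ⟨i, j, hi, hj, rfl⟩
  · by_cases hi : (i : ℕ) < n - 1
    · have := mem_T_or_mem_T'_of_adj hm hG hH hs hi h.symm
      simp at this
    · left
      simp [Fin.ext_iff]
      omega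
  · exact absurd (hH.mem h.symm) hz
  · right
    simp [Fin.ext_iff]
    omega

theorem not_hasCycleOn_ne_w (hm : 1 ≤ m) (hn : 2 ≤ n) :
    ¬ HasCycleOn (blowUp n m) {v | v ≠ w} := by
  classical
  intro h
  obtain ⟨H, hG, hH⟩ := h.exists_isCycleGraphOn
  have hs : ∀ v : BlowUpVertex n m, v ≠ z → v ≠ w → v ∈ {v : BlowUpVertex n m | v ≠ w} :=
    fun v _ h => h
  let i : Fin n := ⟨n - 1, by omega⟩
  -- Both sets have `m + 1` elements, so they would contain the whole cycle; a vertex of `T 0` lies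
  -- outside because `n ≥ 2`.
  have := hH.mem_or_mem_of_card_le (T := insert z (T i)) (N := insert (x i) (F i))
    (v := t ⟨0, by omega⟩ ⟨0, hm⟩)
    (fun v hv => by
      rcases Finset.mem_insert.1 hv with rfl | hv
      · simp
      · obtain ⟨j, rfl⟩ := mem_T.1 hv; simp)
    (fun v hv => by
      rcases Finset.mem_insert.1 hv with rfl | hv
      · simp
      · obtain ⟨j, rfl⟩ := mem_F.1 hv; simp)
    (fun v hv u hvu => by
      rcases Finset.mem_insert.1 hv with rfl | hv
      · rcases eq_or_eq_of_adj_z hm (by omega) hG hH hs (by simp) hvu with rfl | rfl <;> simp [i]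
      · exact Finset.mem_insert.2 (mem_of_adj_T hG hv hvu))
    ⟨z, by simp⟩
    (by rw [Finset.card_insert_of_notMem (by simp), Finset.card_insert_of_notMem (by simp)]; simp)
    (by simp)
  simp [i] at this
  omega

theorem not_hasCycleOn_ne_z (hm : 1 ≤ m) (hn : 3 ≤ n) :
    ¬ HasCycleOn (blowUp n m) {v | v ≠ z} := by
  classical
  intro h
  obtain ⟨H, hG, hH⟩ := h.exists_isCycleGraphOn
  have hs : ∀ v : BlowUpVertex n m, v ≠ z → v ≠ w → v ∈ {v : BlowUpVertex n m | v ≠ z} :=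
    fun v h _ => h
  obtain ⟨i, hi⟩ : ∃ i : Fin n, (i : ℕ) = n - 1 := ⟨⟨n - 1, by omega⟩, rfl⟩
  obtain ⟨k, hk⟩ : ∃ k : Fin n, (k : ℕ) = n - 2 := ⟨⟨n - 2, by omega⟩, rfl⟩
  obtain ⟨k', hk'⟩ : ∃ k' : Fin (n - 1), (k' : ℕ) = n - 2 := ⟨⟨n - 2, by omega⟩, rfl⟩
  have hkk : k'.castLE (n.sub_le 1) = k := by ext; simp; omega
  have hwadj : ∀ u, H.Adj w u → u = x i ∨ u = f' k' ⟨0, by omega⟩ := by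
    intro u hu
    convert eq_or_eq_of_adj_w hm (by omega) hG hH hs (by simp) hu
  have hxw : H.Adj (x i) w := (hH.adj_of_forall (by simp) hwadj).1.symm
  obtain ⟨j, hxt⟩ := exists_adj_t hm hG hH hs i
  have hx : ∀ u, H.Adj (x i) u → u = w ∨ u = t i j := fun u hu =>
    hH.eq_or_eq hxw hxt (by simp) hu
  -- Exactly two edge ends in `F i ∪ {x i}` do not lead to `T i`. One is the edge from `x i` to `w`;
  -- the other can only go to the preceding clique.
  obtain ⟨v, hv, u, hu, hvu⟩ : ∃ v ∈ F i, ∃ u ∈ F k, H.Adj v u := by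
    have hT : ∀ v ∈ T i, v ∈ {v : BlowUpVertex n m | v ≠ z} :=
      fun v hv => by obtain ⟨j, rfl⟩ := mem_T.1 hv; simp
    have hN : ∀ v ∈ insert (x i) (F i), v ∈ {v : BlowUpVertex n m | v ≠ z} := by
      intro v hv
      rcases Finset.mem_insert.1 hv with rfl | hv
      · simp
      · obtain ⟨j, rfl⟩ := mem_F.1 hv; simp
    have hTN : ∀ v ∈ T i, ∀ u, H.Adj v u → u ∈ insert (x i) (F i) := fun v hv u hvu =>
      Finset.mem_insert.2 (mem_of_adj_T hG hv hvu)
    have hc : (insert (x i) (F i) : Finset (BlowUpVertex n m)).card = (T i : Finset (BlowUpVertex n m)).card + 1 := by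
      rw [Finset.card_insert_of_notMem (by simp)]; simp
    obtain ⟨v, hv, u, hu, hvu, hne⟩ := hH.exists_adj_ne hT hN hTN hc.ge (x i) w
    rcases Finset.mem_insert.1 hv with rfl | hvF
    · rcases hx u hvu with rfl | rfl
      · exact absurd rfl hne
      · simp at hu
    · refine ⟨v, hvF, u, ?_, hvu⟩
      obtain ⟨l, rfl⟩ := mem_F.1 hvF
      rcases u with i' | ⟨i', l'⟩ | ⟨i', l'⟩ | _ | _ | ⟨i', l'⟩ | ⟨i', l'⟩
      · by_cases hi' : (i' : ℕ) < n - 1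
        · have := mem_T_or_mem_T'_of_adj hm hG hH hs hi' hvu.symm
          simp at this
        · obtain rfl : i' = i := by ext; omega
          have := hx _ hvu.symm
          simp at this
      · rcases blowUp_adj_f_f_iff.1 (hG hvu) with h | h | h
        · obtain ⟨rfl, h⟩ := h
          -- An edge inside `F i` counts from both ends, making three with `x i` to `w`.
          exact (hH.not_three_adj hT hN hTN hc.le (e₁ := (x i, w)) (e₂ := (f i l, f i l'))
            (e₃ := (f i l', f i l)) ⟨by simp, hxw, by simp⟩ ⟨by simp, hvu, by simp⟩
            ⟨by simp, hvu.symm, by simp⟩ (by simp) (by simp) (by simp [h])).elim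
        · omega
        · obtain rfl : i' = k := by ext; omega
          simp
      · have := hG hvu
        simp [blowUp, BlowUpVertex.Rel] at this
      · exact absurd rfl (hH.mem hvu.symm)
      · have := hwadj _ hvu.symm
        simp at this
      · have := mem_of_adj_T hG (i := i') (by simp) hvu.symm
        simp at this
        subst this
        simp at hu
      · have := mem_of_adj_T' hG (i := i') (by simp) hvu.symm
        simp at this
  -- Here the sizes are `3m + 1` and at most `3m + 2`, and the edge `vu` inside the larger set
  -- absorbs the excess. A vertex of `T 0` is outside since `n ≥ 3`.
  have := hH.mem_or_mem_of_adj (T := insert w (T i ∪ (T k ∪ T' k')))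
    (N := insert (x i) (insert (x k) (F i ∪ (F k ∪ F' k')))) (a := v) (b := u)
    (v := t ⟨0, by omega⟩ ⟨0, hm⟩)
    (fun v hv => by
      rintro rfl
      simp at hv)
    (fun v hv => by
      rintro rfl
      simp at hv)
    (fun v hv u hvu => by
      simp only [Finset.mem_insert, Finset.mem_union] at hv ⊢
      rcases hv with rfl | hv | hv | hv
      · rcases hwadj u hvu with rfl | rfl <;> simp
      · have := mem_of_adj_T hG hv hvu
        tauto
      · have := mem_of_adj_T hG hv hvu
        tauto
      · have := mem_of_adj_T' hG hv hvu
        rw [hkk] at this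
        tauto)
    ⟨w, by simp⟩
    (by
      have hik : i ≠ k := by rw [ne_eq, Fin.ext_iff]; omega
      rw [Finset.card_insert_of_notMem (a := w) (by simp), Finset.card_union_of_disjoint,
        Finset.card_union_of_disjoint]
      · refine (Finset.card_insert_le _ _).trans ?_
        refine (Nat.add_le_add_right (Finset.card_insert_le _ _) _).trans ?_
        have h1 := Finset.card_union_le (F k : Finset (BlowUpVertex n m)) (F' k')
        have h2 := Finset.card_union_le (F i : Finset (BlowUpVertex n m)) (F k ∪ F' k')
        simp only [card_F, card_F', card_T, card_T'] at *
        omega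
      · simp [Finset.disjoint_left]
      · simp [Finset.disjoint_left, hik.symm])
    hvu (by simp_all) (by simp_all)
    (by obtain ⟨l, rfl⟩ := mem_F.1 hv; simp) (by obtain ⟨l, rfl⟩ := mem_F.1 hu; simp)
    (by simp)
  simp [Fin.ext_iff] at this
  omega

end NoCycle

theorem not_isCycleExtendible_blowUp (hm : 1 ≤ m) (hn : 3 ≤ n)
    (h : HasCycleOn (blowUp n m) {v | v ≠ z ∧ v ≠ w}) : ¬ IsCycleExtendible (blowUp n m) := by
  intro hext
  obtain ⟨s', hs', hss, hcard⟩ := hext _ h (by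
    intro h
    have : (z : BlowUpVertex n m) ∈ {v : BlowUpVertex n m | v ≠ z ∧ v ≠ w} := h ▸ Set.mem_univ _
    simp at this)
  obtain ⟨a, ha, has⟩ := Set.exists_of_ssubset hss
  have : s' = insert a {v : BlowUpVertex n m | v ≠ z ∧ v ≠ w} := by
    symm
    refine Set.eq_of_subset_of_ncard_le (Set.insert_subset ha hss.subset) ?_
    rw [Set.ncard_insert_of_notMem has, hcard]
  have haz : a = z ∨ a = w := by
    by_contra! hcon
    exact has hcon
  rcases haz with rfl | rfl
  · refine not_hasCycleOn_ne_w (n := n) (m := m) hm (by omega) ?_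
    convert hs'
    rw [this]
    ext v
    by_cases hv : v = z
    · simp [hv]
    · simp [hv]
  · refine not_hasCycleOn_ne_z (n := n) (m := m) hm hn ?_
    convert hs'
    rw [this]
    ext v
    by_cases hv : v = w
    · simp [hv]
    · simp [hv]

/-! ### Vertex connectivity -/

section Connectivity

theorem connected_of_forall_reachable {V : Type*} {G : SimpleGraph V} (c : V)
    (h : ∀ v, G.Reachable v c) : G.Connected :=
  have : Nonempty V := ⟨c⟩
  ⟨fun u v => (h u).trans (h v).symm⟩

theorem exists_f_notMem_or (D : Finset (BlowUpVertex n m)) (hD : D.card < m + 1) (i : Fin n) :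
    x i ∉ D ∨ ∃ j, f i j ∉ D := by
  by_contra! h
  have h1 : insert (x i) (F i) ⊆ D := by
    intro v hv
    rcases Finset.mem_insert.1 hv with rfl | hv
    · exact h.1
    · obtain ⟨j, rfl⟩ := mem_F.1 hv
      exact h.2 j
  have := Finset.card_le_card h1
  rw [Finset.card_insert_of_notMem (by simp), card_F] at this
  omega

theorem exists_f'_notMem_or (D : Finset (BlowUpVertex n m)) (hD : D.card < m + 1)
    (i : Fin (n - 1)) : x (i.castLE (n.sub_le 1)) ∉ D ∨ ∃ j, f' i j ∉ D := by
  by_contra! h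
  have h1 : insert (x (i.castLE (n.sub_le 1))) (F' i) ⊆ D := by
    intro v hv
    rcases Finset.mem_insert.1 hv with rfl | hv
    · exact h.1
    · obtain ⟨j, rfl⟩ := mem_F'.1 hv
      exact h.2 j
  have := Finset.card_le_card h1
  rw [Finset.card_insert_of_notMem (by simp), card_F'] at this
  omega

/-- A surviving `x i` dominates everything outside the independent sets, and each vertex of those
has `m + 1` neighbours, too many to delete. -/
theorem connected_induce_of_x_notMem (D : Finset (BlowUpVertex n m)) (hD : D.card < m + 1)
    (i : Fin n) (hi : x i ∉ D) : ((blowUp n m).induce {v | v ∉ D}).Connected := by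
  refine connected_of_forall_reachable ⟨x i, hi⟩ ?_
  have key : ∀ (v : BlowUpVertex n m) (hv : v ∉ D), (∀ k j, v ≠ t k j) → (∀ k j, v ≠ t' k j) →
      ((blowUp n m).induce {v | v ∉ D}).Reachable ⟨v, hv⟩ ⟨x i, hi⟩ := by
    intro v hv h1 h2
    by_cases hvx : v = x i
    · subst hvx
      rfl
    · refine SimpleGraph.Adj.reachable ?_
      rw [SimpleGraph.comap_adj]
      exact (blowUp_adj_x_iff.2 ⟨hvx, fun k j h => absurd h (h1 k j),
        fun k j h => absurd h (h2 k j)⟩).symm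
  have key2 : ∀ (v u : BlowUpVertex n m) (hv : v ∉ D), u ∉ D → (blowUp n m).Adj v u →
      (∀ k j, u ≠ t k j) → (∀ k j, u ≠ t' k j) →
      ((blowUp n m).induce {v | v ∉ D}).Reachable ⟨v, hv⟩ ⟨x i, hi⟩ := by
    intro v u hv hu hvu h1 h2
    have : ((blowUp n m).induce {v | v ∉ D}).Adj ⟨v, hv⟩ ⟨u, hu⟩ := hvu
    exact this.reachable.trans (key u hu h1 h2)
  rintro ⟨v, hv⟩
  rcases v with k | ⟨k, l⟩ | ⟨k, l⟩ | _ | _ | ⟨k, l⟩ | ⟨k, l⟩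
  · exact key _ _ (by simp) (by simp)
  · exact key _ _ (by simp) (by simp)
  · exact key _ _ (by simp) (by simp)
  · exact key _ _ (by simp) (by simp)
  · exact key _ _ (by simp) (by simp)
  · rcases exists_f_notMem_or D hD k with h | ⟨j, h⟩
    · exact key2 _ _ hv h (blowUp_adj_t_iff.2 (by simp)) (by simp) (by simp)
    · exact key2 _ _ hv h (blowUp_adj_t_iff.2 (by simp)) (by simp) (by simp)
  · rcases exists_f'_notMem_or D hD k with h | ⟨j, h⟩
    · exact key2 _ _ hv h (blowUp_adj_t'_iff.2 (by simp)) (by simp) (by simp)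
    · exact key2 _ _ hv h (blowUp_adj_t'_iff.2 (by simp)) (by simp) (by simp)

theorem connected_induce_of_forall_x (hm : 1 ≤ m) (D : Finset (BlowUpVertex n m))
    (hD : ∀ v, v ∈ D ↔ ∃ i, x i = v) : ((blowUp n m).induce {v | v ∉ D}).Connected := by
  let K := (blowUp n m).induce {v | v ∉ D}
  have hmem : ∀ v : BlowUpVertex n m, (∀ i, x i ≠ v) → v ∉ D := by
    intro v hv h
    obtain ⟨i, hi⟩ := (hD v).1 h
    exact hv i hi
  have hz : z ∉ D := hmem z (by simp)
  have hw : w ∉ D := hmem w (by simp)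
  have hf : ∀ i j, f i j ∉ D := fun i j => hmem _ (by simp)
  have hf' : ∀ i j, f' i j ∉ D := fun i j => hmem _ (by simp)
  have step : ∀ {v u : BlowUpVertex n m} (hv : v ∉ D) (hu : u ∉ D),
      v = u ∨ (blowUp n m).Adj v u → K.Reachable ⟨u, hu⟩ ⟨z, hz⟩ → K.Reachable ⟨v, hv⟩ ⟨z, hz⟩ := by
    rintro v u hv hu (rfl | hvu) h
    · exact h
    · have : K.Adj ⟨v, hv⟩ ⟨u, hu⟩ := hvu
      exact this.reachable.trans h
  have hF : ∀ d, ∀ i : Fin n, (i : ℕ) + 1 + d = n → ∀ j, K.Reachable ⟨f i j, hf i j⟩ ⟨z, hz⟩ := by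
    intro d
    induction d with
    | zero =>
      intro i hi j
      refine step _ (hf i ⟨m - 1, by omega⟩) ?_ (step _ hz (Or.inr ?_) (by rfl))
      · rw [blowUp_adj_f_f_iff]
        by_cases hj : j = ⟨m - 1, by omega⟩ <;> simp [hj]
      · exact (blowUp_adj_z_iff.2 (Or.inr (Or.inr ⟨_, _, by omega,
          by simp only; omega, rfl⟩))).symm
    | succ d ih =>
      intro i hi j
      refine step _ (hf i ⟨m - 1, by omega⟩) ?_ (step _ (hf ⟨i + 1, by omega⟩ ⟨0, by omega⟩)
        (Or.inr ?_) (ih _ (by simp only; omega) _))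
      · rw [blowUp_adj_f_f_iff]
        by_cases hj : j = ⟨m - 1, by omega⟩ <;> simp [hj]
      · exact blowUp_adj_f_f_iff.2 (Or.inr (Or.inl ⟨rfl, by simp only; omega, rfl⟩))
  have hF' : ∀ d, ∀ i : Fin (n - 1), (i : ℕ) + 1 + d = n - 1 →
      ∀ j, K.Reachable ⟨f' i j, hf' i j⟩ ⟨z, hz⟩ := by
    intro d
    induction d with
    | zero =>
      intro i hi j
      refine step _ (hf' i ⟨0, by omega⟩) ?_ (step _ hw (Or.inr ?_)
        (step _ hz (Or.inr ?_) (by rfl)))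
      · rw [blowUp_adj_f'_f'_iff]
        by_cases hj : j = ⟨0, by omega⟩ <;> simp [hj]
      · exact (blowUp_adj_w_iff.2 (Or.inr (Or.inr ⟨_, _, by omega, rfl, rfl⟩))).symm
      · exact blowUp_adj_w_iff.2 (by simp)
    | succ d ih =>
      intro i hi j
      refine step _ (hf' i ⟨0, by omega⟩) ?_ (step _ (hf' ⟨i + 1, by omega⟩ ⟨m - 1, by omega⟩)
        (Or.inr ?_) (ih _ (by simp only; omega) _))
      · rw [blowUp_adj_f'_f'_iff]
        by_cases hj : j = ⟨0, by omega⟩ <;> simp [hj]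
      · exact blowUp_adj_f'_f'_iff.2 (Or.inr (Or.inr ⟨rfl, by simp only; omega, rfl⟩))
  refine connected_of_forall_reachable ⟨z, hz⟩ ?_
  rintro ⟨v, hv⟩
  rcases v with k | ⟨k, l⟩ | ⟨k, l⟩ | _ | _ | ⟨k, l⟩ | ⟨k, l⟩
  · exact absurd ((hD _).2 ⟨k, rfl⟩) hv
  · exact hF (n - 1 - k) k (by omega) l
  · exact hF' (n - 2 - k) k (by omega) l
  · rfl
  · exact step _ hz (Or.inr (blowUp_adj_w_iff.2 (by simp))) (by rfl)
  · exact step _ (hf k ⟨0, hm⟩) (Or.inr (blowUp_adj_t_iff.2 (by simp)))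
      (hF (n - 1 - k) k (by omega) _)
  · exact step _ (hf' k ⟨0, hm⟩) (Or.inr (blowUp_adj_t'_iff.2 (by simp)))
      (hF' (n - 2 - k) k (by omega) _)

theorem hasConnectivity_blowUp (hm : 1 ≤ m) (hmn : m ≤ n) : HasConnectivity (blowUp n m) (m + 1) := by
  have hn : 0 < n := by omega
  refine ⟨⟨?_, ?_⟩, ?_⟩
  · have h : (insert z (insert w (F ⟨0, hn⟩)) : Finset (BlowUpVertex n m)).card ≤ _ :=
      Finset.card_le_univ _
    rw [Finset.card_insert_of_notMem (by simp), Finset.card_insert_of_notMem (by simp),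
      card_F] at h
    omega
  · intro D hD
    by_cases h : ∃ i, x i ∉ D
    · obtain ⟨i, hi⟩ := h
      exact connected_induce_of_x_notMem D hD i hi
    · push Not at h
      refine connected_induce_of_forall_x hm D ?_
      -- Since `D.card ≤ m ≤ n`, deleting every central vertex leaves nothing else to delete.
      have h1 : Finset.univ.image (x : Fin n → BlowUpVertex n m) = D := by
        refine Finset.eq_of_subset_of_card_le (by simpa [Finset.subset_iff] using h) ?_
        rw [Finset.card_image_of_injective _ (fun a b h => by simpa using h), Finset.card_univ,
          Fintype.card_fin]
        omega
      intro v
      simp [← h1]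
  · rintro ⟨-, h⟩
    -- These `m + 1` vertices are all the neighbours of each vertex in `T 0`.
    have hc := h (insert (x ⟨0, hn⟩) (F ⟨0, hn⟩)) (by
      rw [Finset.card_insert_of_notMem (by simp), card_F]
      omega)
    obtain ⟨p⟩ := hc.preconnected ⟨t ⟨0, hn⟩ ⟨0, hm⟩, by simp⟩ ⟨z, by simp⟩
    cases p with
    | @cons _ u _ hu q =>
      obtain ⟨u, hu'⟩ := u
      have := blowUp_adj_t_iff.1 (show (blowUp n m).Adj _ u from hu)
      rcases this with rfl | ⟨l, rfl⟩ <;> simp at hu'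

end Connectivity

/-! ### Serpentine paths and the long cycles -/

section Paths

/-- The number of the block that contains a vertex, `n` for `z` and `w`. -/
def BlowUpVertex.level : BlowUpVertex n m → ℕ
  | .x i => i
  | .f i _ => i
  | .f' i _ => i
  | .z => n
  | .w => n
  | .t i _ => i
  | .t' i _ => i

theorem hasPathOn_F_union_T (i : Fin n) (j l : Fin m) :
    HasPathOn (blowUp n m) (f i j) (t i l) {v | v ∈ F i ∨ v ∈ T i} :=
  hasPathOn_union_of_forall_adj (F := F i) (T := T i) (by simp)
    (by simp [Finset.disjoint_left])
    (by
      intro v hv u hu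
      obtain ⟨j, rfl⟩ := mem_F.1 hv
      obtain ⟨l, rfl⟩ := mem_T.1 hu
      exact (blowUp_adj_t_iff.2 (by simp)).symm)
    (by simp) (by simp)

theorem hasPathOn_F'_union_T' (i : Fin (n - 1)) (j l : Fin m) :
    HasPathOn (blowUp n m) (f' i j) (t' i l) {v | v ∈ F' i ∨ v ∈ T' i} :=
  hasPathOn_union_of_forall_adj (F := F' i) (T := T' i) (by simp)
    (by simp [Finset.disjoint_left])
    (by
      intro v hv u hu
      obtain ⟨j, rfl⟩ := mem_F'.1 hv
      obtain ⟨l, rfl⟩ := mem_T'.1 hu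
      exact (blowUp_adj_t'_iff.2 (by simp)).symm)
    (by simp) (by simp)

theorem hasPathOn_block (hm : 1 ≤ m) {i : ℕ} (hi : i < n - 1) (j l : Fin m) :
    HasPathOn (blowUp n m) (f ⟨i, by omega⟩ j) (f' ⟨i, hi⟩ l) {v | v.level = i} := by
  have h := ((hasPathOn_F_union_T ⟨i, by omega⟩ j ⟨0, hm⟩).trans
    (blowUp_adj_t_iff.2 (Or.inl rfl)) (HasPathOn.singleton _ _) (by simp)).trans
    (blowUp_adj_t'_iff (i := ⟨i, hi⟩) (j := ⟨0, hm⟩).2 (Or.inl rfl)).symm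
    (hasPathOn_F'_union_T' ⟨i, hi⟩ l ⟨0, hm⟩).symm
    (by
      rw [Set.disjoint_left]
      rintro v ((hv | hv) | hv)
      · obtain ⟨j, rfl⟩ := mem_F.1 hv; simp
      · obtain ⟨j, rfl⟩ := mem_T.1 hv; simp
      · obtain rfl : v = _ := hv; simp)
  convert h using 1
  ext v
  rcases v with k | ⟨k, l⟩ | ⟨k, l⟩ | _ | _ | ⟨k, l⟩ | ⟨k, l⟩ <;>
    simp [BlowUpVertex.level, Fin.ext_iff, eq_comm]
  all_goals omega

/-- The serpentine through the first blocks that ends at the last vertex of the clique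
`x_0, …, x_{n-1}`. -/
theorem hasPathOn_level_le (hm : 1 ≤ m) {i : Fin n} (hi : (i : ℕ) = n - 1) {d : ℕ}
    (hd : d < n - 1) :
    HasPathOn (blowUp n m) (f ⟨d, by omega⟩ ⟨m - 1, by omega⟩) (x i)
      {v | v.level ≤ d ∨ v = x i} ∧
    HasPathOn (blowUp n m) (f' ⟨d, by omega⟩ ⟨0, hm⟩) (x i)
      {v | v.level ≤ d ∨ v = x i} := by
  have hX : (x i : BlowUpVertex n m).level = n - 1 := hi
  induction d with
  | zero =>
    have hset : {v : BlowUpVertex n m | v.level ≤ 0 ∨ v = x i} = {v | v.level = 0} ∪ {x i} := by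
      ext v; simp [or_comm]
    have hdis : Disjoint {v : BlowUpVertex n m | v.level = 0} {(x i : BlowUpVertex n m)} := by
      simp [hX]; omega
    rw [hset]
    refine ⟨(hasPathOn_block hm hd _ ⟨0, hm⟩).trans ?_ (HasPathOn.singleton _ _) hdis,
      (hasPathOn_block hm hd ⟨0, hm⟩ _).symm.trans ?_ (HasPathOn.singleton _ _) hdis⟩
    · exact (blowUp_adj_x_iff.2 (by simp)).symm
    · exact (blowUp_adj_x_iff.2 (by simp)).symm
  | succ d ih =>
    have hd' : d < n - 1 := by omega
    obtain ⟨ih1, ih2⟩ := ih hd'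
    have hset : {v : BlowUpVertex n m | v.level ≤ d + 1 ∨ v = x i} =
        {v | v.level = d + 1} ∪ {v | v.level ≤ d ∨ v = x i} := by
      ext v
      simp only [Set.mem_union, Set.mem_ofPred_eq]
      rw [Nat.le_succ_iff]
      tauto
    have hdis : Disjoint {v : BlowUpVertex n m | v.level = d + 1}
        {v | v.level ≤ d ∨ v = x i} := by
      rw [Set.disjoint_left]
      rintro v (hv : v.level = d + 1) (h | rfl) <;> omega
    rw [hset]
    -- Crossing a block switches sides, so each of the two claims uses the other for the preceding
    -- block.
    refine ⟨(hasPathOn_block hm hd _ ⟨m - 1, by omega⟩).trans ?_ ih2 hdis,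
      (hasPathOn_block hm hd ⟨0, hm⟩ _).symm.trans ?_ ih1 hdis⟩
    · exact blowUp_adj_f'_f'_iff.2 (Or.inr (Or.inl ⟨rfl, by simp only; omega, rfl⟩))
    · exact blowUp_adj_f_f_iff.2 (Or.inr (Or.inr ⟨rfl, by simp only; omega, rfl⟩))

theorem hasPathOn_extend_last {i : Fin n} (hi : (i : ℕ) = n - 1) {a : BlowUpVertex n m}
    {s : Set (BlowUpVertex n m)} (hs : ∀ v, v ∈ s ↔ v.level < n - 1 ∨ v = x i)
    (h : HasPathOn (blowUp n m) a (x i) s) (j : Fin m) :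
    HasPathOn (blowUp n m) a (f i j) {v | v ≠ z ∧ v ≠ w} := by
  have h1 := h.trans (blowUp_adj_t_iff.2 (Or.inl rfl)).symm (hasPathOn_F_union_T i j j).symm
    (by
      rw [Set.disjoint_right]
      rintro v (hv | hv) <;> rw [hs]
      · obtain ⟨j, rfl⟩ := mem_F.1 hv; simp [BlowUpVertex.level, hi]
      · obtain ⟨j, rfl⟩ := mem_T.1 hv; simp [BlowUpVertex.level, hi])
  convert h1 using 1
  ext v
  simp only [Set.mem_union, hs]
  rcases v with k | ⟨k, l⟩ | ⟨k, l⟩ | _ | _ | ⟨k, l⟩ | ⟨k, l⟩ <;>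
    simp [BlowUpVertex.level, Fin.ext_iff, eq_comm]
  all_goals omega

theorem hasCycleOn_ne_z_ne_w (hm : 1 ≤ m) (hn : 2 ≤ n) :
    HasCycleOn (blowUp n m) {v | v ≠ z ∧ v ≠ w} := by
  have h := hasPathOn_extend_last rfl (by
    intro v
    simp only [Set.mem_ofPred_eq]
    have : v.level ≤ n - 2 ↔ v.level < n - 1 := by omega
    rw [this]) (hasPathOn_level_le (n := n) (i := ⟨n - 1, by omega⟩) hm rfl (d := n - 2)
      (by omega)).1 ⟨0, hm⟩
  refine h.hasCycleOn (c := x ⟨0, by omega⟩) ?_ (by simp) (by simp) (by simp)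
  -- The closing edge joins the last two cliques `F`.
  exact blowUp_adj_f_f_iff.2 (Or.inr (Or.inr ⟨by simp only; omega, by simp only; omega, rfl⟩))

theorem isHamiltonian_blowUp (hm : 1 ≤ m) (hn : 1 ≤ n) : (blowUp n m).IsHamiltonian := by
  apply HasCycleOn.isHamiltonian
  obtain ⟨i, hi⟩ : ∃ i : Fin n, (i : ℕ) = n - 1 := ⟨⟨n - 1, by omega⟩, rfl⟩
  obtain ⟨a, ha, haw, hp⟩ : ∃ a, (blowUp n m).Adj w a ∧ a ≠ z ∧
      HasPathOn (blowUp n m) a (f i ⟨m - 1, by omega⟩) {v | v ≠ z ∧ v ≠ w} := by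
    -- For `n = 1` there is no `F'`, and `w` is joined to the only central vertex instead.
    obtain rfl | hn := hn.eq_or_lt
    · refine ⟨x i, blowUp_adj_w_iff.2 (by simp), by simp, hasPathOn_extend_last hi (fun v => ?_)
        (HasPathOn.singleton _ _) _⟩
      simp
    · refine ⟨f' ⟨n - 2, by omega⟩ ⟨0, hm⟩, blowUp_adj_w_iff.2 ?_, by simp,
        hasPathOn_extend_last hi (fun v => ?_) (s := {v | v.level ≤ n - 2 ∨ v = x i}) ?_ _⟩
      · exact Or.inr (Or.inr ⟨_, _, by simp only; omega, rfl, rfl⟩)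
      · simp only [Set.mem_ofPred_eq]
        have : v.level ≤ n - 2 ↔ v.level < n - 1 := by omega
        rw [this]
      · exact (hasPathOn_level_le hm hi (by omega)).2
  have h := (hp.trans (blowUp_adj_z_iff.2 (Or.inr (Or.inr ⟨_, _, by omega, by simp only; omega,
    rfl⟩))).symm (HasPathOn.singleton _ z) (by simp)).trans (blowUp_adj_z_iff.2 (by simp))
    (HasPathOn.singleton _ w) (by simp)
  have h2 := h.hasCycleOn (c := z) ha (by simp) haw.symm (by simp)
  convert h2
  ext v
  simp
  tauto

end Paths

/-! ### Assembly -/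

theorem mainTheorem3 (k : ℕ) (hk : 2 ≤ k) :
    (∃ (V : Type) (_ : Fintype V) (_ : DecidableEq V) (G : SimpleGraph V),
      G.IsHamiltonian ∧ IsChordal G ∧ HasConnectivity G k ∧ ¬ IsCycleExtendible G) ∧
    (IsChordal (blowUpS (k - 1)) ∧ (blowUpS (k - 1)).IsHamiltonian ∧
      HasConnectivity (blowUpS (k - 1)) k) ∧
    (3 ≤ k →
      HasCycleOn (blowUpS (k - 1)) {v | v ≠ .z ∧ v ≠ .w} ∧
      ¬ HasCycleOn (blowUpS (k - 1)) {v | v ≠ .w}) ∧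
    (4 ≤ k →
      ¬ HasCycleOn (blowUpS (k - 1)) {v | v ≠ .z} ∧
      ¬ IsCycleExtendible (blowUpS (k - 1))) := by
  have hconn : ∀ n, k - 1 ≤ n → HasConnectivity (blowUp n (k - 1)) k := fun n hn => by
    have := hasConnectivity_blowUp (n := n) (m := k - 1) (by omega) hn
    rwa [Nat.sub_add_cancel (by omega)] at this
  -- Block size `k - 1` fixes the connectivity, while the obstruction needs three central vertices;
  -- the maximum secures both when `k` is `2` or `3`.
  refine ⟨⟨BlowUpVertex (max 3 (k - 1)) (k - 1), inferInstance, inferInstance, blowUp _ _,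
    isHamiltonian_blowUp (by omega) (by omega), isChordal_blowUp, hconn _ (by omega),
    not_isCycleExtendible_blowUp (by omega) (by omega)
      (hasCycleOn_ne_z_ne_w (by omega) (by omega))⟩,
    ⟨isChordal_blowUp, isHamiltonian_blowUp (by omega) (by omega), hconn _ le_rfl⟩,
    fun h => ⟨hasCycleOn_ne_z_ne_w (by omega) (by omega),
      not_hasCycleOn_ne_w (by omega) (by omega)⟩,
    fun h => ⟨not_hasCycleOn_ne_z (by omega) (by omega),
      not_isCycleExtendible_blowUp (by omega) (by omega)
        (hasCycleOn_ne_z_ne_w (by omega) (by omega))⟩⟩
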